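/- Let $k$ be a field and let $Q$ be a finite connected quiver (finite sets $Q_0$ of vertices, non-empty, and $Q_1$ of arrows) without oriented cycles other than the vertices. Let $Z$ be a minimal set of paths of length at least two of $Q$, that is, a set of such paths in which no path has a strict sub-path belonging to $Z$. Let $kQ$ be the path algebra, let $\langle Z\rangle$ be the two-sided ideal generated by $Z$, and let $\Lambda = kQ/\langle Z\rangle$. Let $H^1(\Lambda,\Lambda)$ be the first Hochschild cohomology space, i.e. the space of $k$-linear derivations $\Lambda\to\Lambda$ modulo the inner derivations $\lambda \mapsto \lambda x - x\lambda$. Then $H^1(\Lambda,\Lambda)$ is finite dimensional over $k$ and $$\dim_k H^1(\Lambda,\Lambda)\ \ge\ 1-|Q_0|+|Q_1| .$$ -/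

import Mathlib

noncomputable section

namespace MonomialHochschild

/-! ### Paths in a quiver -/

section Paths

variable (V : Type*) [Quiver V]

/-- The set of all paths of the quiver: a triple (source, target, path). The paths of length
zero are the vertices. -/
abbrev QPath : Type _ := Σ a b : V, Quiver.Path a b

variable {V}

/-- The source vertex of a path. -/
abbrev QPath.source (p : QPath V) : V := p.1

/-- The terminal vertex of a path. -/
abbrev QPath.target (p : QPath V) : V := p.2.1

/-- The number of arrows of a path. -/
def QPath.length (p : QPath V) : ℕ := p.2.2.length

/-- The path of length zero at a vertex. -/
def QPath.vertex (v : V) : QPath V := ⟨v, v, Quiver.Path.nil⟩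

/-- The path `p q`, that is first `q` and then `p`, when `q` ends where `p` starts. -/
def QPath.comp (p q : QPath V) (h : q.target = p.source) : QPath V :=
  ⟨q.source, p.target, q.2.2.comp (p.2.2.cast h.symm rfl)⟩

/-- `γ` is a sub-path of `δ`: the path `δ` is a concatenation of some path, `γ`, some path. -/
def QPath.IsSubpath (γ δ : QPath V) : Prop :=
  ∃ (u : Quiver.Path δ.source γ.source) (v : Quiver.Path γ.target δ.target),
    δ.2.2 = (u.comp γ.2.2).comp v

/-- A set of paths is minimal if no path of the set has a strict sub-path in the set. -/
def IsMinimalPathSet (Z : Set (QPath V)) : Prop :=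
  ∀ δ ∈ Z, ∀ γ ∈ Z, γ.IsSubpath δ → γ = δ

variable (V)

/-- There are no oriented cycles besides the vertices. -/
def NoOrientedCycles : Prop :=
  ∀ (v : V) (p : Quiver.Path v v), p.length = 0

/-- The quiver is connected: there is a vertex, and any two vertices are joined by a zigzag of
arrows. -/
def IsConnectedQuiver : Prop :=
  Nonempty V ∧ ∀ a b : V,
    (a : Quiver.WeaklyConnectedComponent V) = (b : Quiver.WeaklyConnectedComponent V)

end Paths

/-! ### The path algebra -/

section PathAlgebra

/-- The vector space of finite linear combinations of paths. -/
def PathAlgebra (k : Type*) [Field k] (V : Type*) [Quiver V] : Type _ := QPath V →₀ k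

variable (k : Type*) [Field k] {V : Type*} [Quiver V]

instance : AddCommGroup (PathAlgebra k V) := inferInstanceAs (AddCommGroup (QPath V →₀ k))

instance : Module k (PathAlgebra k V) := inferInstanceAs (Module k (QPath V →₀ k))

/-- A path as an element of the path algebra. -/
def PathAlgebra.ofPath (p : QPath V) : PathAlgebra k V := Finsupp.single p (1 : k)

variable (V) in
/-- The paths form a basis of the path algebra. -/
def PathAlgebra.basis : Module.Basis (QPath V) k (PathAlgebra k V) :=
  Module.Basis.ofRepr (LinearEquiv.refl k (QPath V →₀ k))

theorem PathAlgebra.basis_apply (p : QPath V) :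
    PathAlgebra.basis k V p = PathAlgebra.ofPath k p := rfl

open Classical in
/-- The product of two paths: their concatenation if it can be done, and zero otherwise. -/
def PathAlgebra.pathMul (p q : QPath V) : PathAlgebra k V :=
  if h : q.target = p.source then PathAlgebra.ofPath k (p.comp q h) else 0

variable (V) in
/-- The bilinear extension of the product of paths. -/
def PathAlgebra.mulHom : PathAlgebra k V →ₗ[k] PathAlgebra k V →ₗ[k] PathAlgebra k V :=
  (PathAlgebra.basis k V).constr k fun p =>
    (PathAlgebra.basis k V).constr k fun q => PathAlgebra.pathMul k p q

instance : Mul (PathAlgebra k V) := ⟨fun x y => PathAlgebra.mulHom k V x y⟩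

instance [Fintype V] : One (PathAlgebra k V) :=
  ⟨∑ v : V, PathAlgebra.ofPath k (QPath.vertex v)⟩

namespace PathAlgebra

theorem mul_def (x y : PathAlgebra k V) : x * y = mulHom k V x y := rfl

theorem one_def [Fintype V] :
    (1 : PathAlgebra k V) = ∑ v : V, ofPath k (QPath.vertex v) := rfl

theorem ofPath_mul_ofPath (p q : QPath V) : ofPath k p * ofPath k q = pathMul k p q := by
  rw [mul_def, mulHom, ← basis_apply, ← basis_apply, Module.Basis.constr_basis,
    Module.Basis.constr_basis]

theorem pathMul_of_eq (p q : QPath V) (h : q.target = p.source) :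
    pathMul k p q = ofPath k (p.comp q h) := dif_pos h

theorem pathMul_of_ne (p q : QPath V) (h : ¬ q.target = p.source) :
    pathMul k p q = 0 := dif_neg h

theorem add_mul' (x y z : PathAlgebra k V) : (x + y) * z = x * z + y * z := by
  simp [mul_def]

theorem mul_add' (x y z : PathAlgebra k V) : x * (y + z) = x * y + x * z := by
  simp [mul_def]

theorem smul_mul' (c : k) (x y : PathAlgebra k V) : (c • x) * y = c • (x * y) := by
  simp [mul_def]

theorem mul_smul' (c : k) (x y : PathAlgebra k V) : x * (c • y) = c • (x * y) := by
  simp [mul_def]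

theorem zero_mul' (x : PathAlgebra k V) : 0 * x = 0 := by simp [mul_def]

theorem mul_zero' (x : PathAlgebra k V) : x * 0 = 0 := by simp [mul_def]

theorem induction_ofPath {P : PathAlgebra k V → Prop} (x : PathAlgebra k V)
    (h0 : P 0) (hadd : ∀ x y, P x → P y → P (x + y)) (hsmul : ∀ (c : k) x, P x → P (c • x))
    (hp : ∀ p, P (ofPath k p)) : P x := by
  have hx := (basis k V).mem_span x
  induction hx using Submodule.span_induction with
  | mem x h => obtain ⟨p, rfl⟩ := h; exact hp p
  | zero => exact h0
  | add x y _ _ hx hy => exact hadd x y hx hy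
  | smul c x _ hx => exact hsmul c x hx

theorem ofPath_mul_assoc (p q r : QPath V) :
    ofPath k p * ofPath k q * ofPath k r = ofPath k p * (ofPath k q * ofPath k r) := by
  obtain ⟨c, d, p⟩ := p
  obtain ⟨b, c', q⟩ := q
  obtain ⟨a, b', r⟩ := r
  rw [ofPath_mul_ofPath, ofPath_mul_ofPath]
  by_cases h₁ : c' = c
  · by_cases h₂ : b' = b
    · subst h₁ h₂
      rw [pathMul_of_eq k _ _ rfl, pathMul_of_eq k _ _ rfl, ofPath_mul_ofPath, ofPath_mul_ofPath,
        pathMul_of_eq k _ _ rfl, pathMul_of_eq k _ _ rfl]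
      simp [QPath.comp]
    · subst h₁
      rw [pathMul_of_eq k _ _ rfl, pathMul_of_ne k _ _ h₂, mul_zero', ofPath_mul_ofPath,
        pathMul_of_ne k _ _ h₂]
  · by_cases h₂ : b' = b
    · subst h₂
      rw [pathMul_of_ne k _ _ h₁, zero_mul', pathMul_of_eq k _ _ rfl, ofPath_mul_ofPath,
        pathMul_of_ne k _ _ h₁]
    · rw [pathMul_of_ne k _ _ h₁, pathMul_of_ne k _ _ h₂, zero_mul', mul_zero']

theorem mul_assoc' (x y z : PathAlgebra k V) : x * y * z = x * (y * z) := by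
  induction x using induction_ofPath k with
  | h0 => simp only [zero_mul']
  | hadd x x' hx hx' => simp only [add_mul', hx, hx']
  | hsmul c x hx => simp only [smul_mul', hx]
  | hp p =>
    induction y using induction_ofPath k with
    | h0 => simp only [zero_mul', mul_zero']
    | hadd x x' hx hx' => simp only [add_mul', mul_add', hx, hx']
    | hsmul c x hx => simp only [smul_mul', mul_smul', hx]
    | hp q =>
      induction z using induction_ofPath k with
      | h0 => simp only [mul_zero']
      | hadd x x' hx hx' => simp only [mul_add', hx, hx']
      | hsmul c x hx => simp only [mul_smul', hx]
      | hp r => exact ofPath_mul_assoc k p q r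

theorem vertex_mul (v : V) (p : QPath V) (h : p.target = v) :
    ofPath k (QPath.vertex v) * ofPath k p = ofPath k p := by
  subst h
  rw [ofPath_mul_ofPath, pathMul_of_eq k _ _ rfl]
  rfl

theorem mul_vertex (v : V) (p : QPath V) (h : v = p.source) :
    ofPath k p * ofPath k (QPath.vertex v) = ofPath k p := by
  subst h
  rw [ofPath_mul_ofPath, pathMul_of_eq k _ _ rfl]
  simp [QPath.comp, QPath.vertex]

theorem one_mul' [Fintype V] (x : PathAlgebra k V) : 1 * x = x := by
  induction x using induction_ofPath k with
  | h0 => exact mul_zero' k 1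
  | hadd x x' hx hx' => rw [mul_add', hx, hx']
  | hsmul c x hx => rw [mul_smul', hx]
  | hp p =>
    rw [one_def, mul_def, map_sum, LinearMap.sum_apply,
      Finset.sum_eq_single p.target (fun v _ hv => ?_) (fun h => absurd (Finset.mem_univ _) h)]
    · exact vertex_mul k _ p rfl
    · rw [← mul_def, ofPath_mul_ofPath, pathMul_of_ne k _ _ hv.symm]

theorem mul_one' [Fintype V] (x : PathAlgebra k V) : x * 1 = x := by
  induction x using induction_ofPath k with
  | h0 => exact zero_mul' k 1
  | hadd x x' hx hx' => rw [add_mul', hx, hx']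
  | hsmul c x hx => rw [smul_mul', hx]
  | hp p =>
    rw [one_def, mul_def, map_sum,
      Finset.sum_eq_single p.source (fun v _ hv => ?_) (fun h => absurd (Finset.mem_univ _) h)]
    · exact mul_vertex k _ p rfl
    · rw [← mul_def, ofPath_mul_ofPath, pathMul_of_ne k _ _ hv]

end PathAlgebra

/-- The path algebra of a quiver with finitely many vertices; its unit element is the sum of the
vertices. -/
instance [Fintype V] : Ring (PathAlgebra k V) where
  __ := (inferInstance : AddCommGroup (PathAlgebra k V))
  mul := (· * ·)
  one := 1
  left_distrib := PathAlgebra.mul_add' k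
  right_distrib := PathAlgebra.add_mul' k
  zero_mul := PathAlgebra.zero_mul' k
  mul_zero := PathAlgebra.mul_zero' k
  mul_assoc := PathAlgebra.mul_assoc' k
  one_mul := PathAlgebra.one_mul' k
  mul_one := PathAlgebra.mul_one' k

instance [Fintype V] : Algebra k (PathAlgebra k V) :=
  Algebra.ofModule (PathAlgebra.smul_mul' k) (PathAlgebra.mul_smul' k)

/-- The two-sided ideal of the path algebra generated by a set of paths. -/
def pathIdeal [Fintype V] (Z : Set (QPath V)) : TwoSidedIdeal (PathAlgebra k V) :=
  TwoSidedIdeal.span (PathAlgebra.ofPath k '' Z)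

/-- The quotient of the path algebra by the two-sided ideal generated by a set of paths. -/
abbrev MonomialAlgebra [Fintype V] (Z : Set (QPath V)) : Type _ :=
  (pathIdeal k Z).ringCon.Quotient

end PathAlgebra

/-! ### The first Hochschild cohomology space -/

section Subquotient

variable {k : Type*} [Field k] {M : Type*} [AddCommGroup M] [Module k M]

/-- The quotient `Z / (B ∩ Z)` of two subspaces of a vector space; it is `Z / B` when `B` is
contained in `Z`. -/
def Subquotient (Z B : Submodule k M) : Type _ := Z ⧸ B.submoduleOf Z

instance (Z B : Submodule k M) : AddCommGroup (Subquotient Z B) :=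
  inferInstanceAs (AddCommGroup (Z ⧸ B.submoduleOf Z))

instance (Z B : Submodule k M) : Module k (Subquotient Z B) :=
  inferInstanceAs (Module k (Z ⧸ B.submoduleOf Z))

end Subquotient

section Hochschild

variable (k : Type*) [Field k] (A : Type*) [Ring A] [Algebra k A]

/-- The differential from zero-cochains to one-cochains of the Hochschild complex of `A` with
coefficients in `A`: it sends `x` to `a ↦ a x - x a`. -/
def hochschildD0 : A →ₗ[k] (A →ₗ[k] A) :=
  (LinearMap.mul k A).flip - LinearMap.mul k A

/-- The differential from one-cochains to two-cochains of the Hochschild complex of `A` with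
coefficients in `A`: it sends `f` to `(a, b) ↦ a f(b) - f(a b) + f(a) b`. -/
def hochschildD1 : (A →ₗ[k] A) →ₗ[k] (A →ₗ[k] A →ₗ[k] A) where
  toFun f := LinearMap.mk₂ k (fun a b => a * f b - f (a * b) + f a * b)
    (fun a a' b => by simp only [add_mul, map_add]; abel)
    (fun c a b => by simp only [smul_mul_assoc, map_smul, smul_add, smul_sub])
    (fun a b b' => by simp only [mul_add, map_add]; abel)
    (fun c a b => by simp only [mul_smul_comm, map_smul, smul_add, smul_sub])
  map_add' f g := by
    ext a b
    simp only [LinearMap.mk₂_apply, LinearMap.add_apply, mul_add, add_mul]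
    abel
  map_smul' c f := by
    ext a b
    simp only [LinearMap.mk₂_apply, LinearMap.smul_apply, mul_smul_comm, smul_mul_assoc,
      smul_add, smul_sub, RingHom.id_apply]

theorem hochschildD0_apply (x a : A) : hochschildD0 k A x a = a * x - x * a := rfl

theorem hochschildD1_apply (f : A →ₗ[k] A) (a b : A) :
    hochschildD1 k A f a b = a * f b - f (a * b) + f a * b := rfl

/-- The one-cocycles are the derivations of `A`. -/
theorem mem_ker_hochschildD1 (f : A →ₗ[k] A) :
    f ∈ LinearMap.ker (hochschildD1 k A) ↔ ∀ a b : A, f (a * b) = a * f b + f a * b := by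
  rw [LinearMap.mem_ker]
  constructor
  · intro h a b
    have h' : a * f b - f (a * b) + f a * b = 0 := by
      rw [← hochschildD1_apply k A f a b, h]; rfl
    rw [← sub_eq_zero, ← neg_eq_zero, ← h']
    abel
  · intro h
    ext a b
    rw [hochschildD1_apply, h a b, LinearMap.zero_apply, LinearMap.zero_apply]
    abel

/-- The one-coboundaries (the inner derivations) are one-cocycles. -/
theorem range_hochschildD0_le :
    LinearMap.range (hochschildD0 k A) ≤ LinearMap.ker (hochschildD1 k A) := by
  rintro _ ⟨x, rfl⟩
  rw [mem_ker_hochschildD1]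
  intro a b
  simp only [hochschildD0_apply, mul_sub, sub_mul, mul_assoc]
  abel

/-- The first Hochschild cohomology space of `A` with coefficients in `A`: the one-cocycles
(derivations) modulo the one-coboundaries (inner derivations). -/
abbrev HH1 : Type _ :=
  Subquotient (LinearMap.ker (hochschildD1 k A)) (LinearMap.range (hochschildD0 k A))

end Hochschild

end MonomialHochschild

end

noncomputable section

namespace MonomialHochschild

/-! ### Finiteness of the set of paths, and weights of paths. -/

section Paths

variable {V : Type*} [Quiver V]

/-! A function `c` on arrows gives a diagonal derivation of the path algebra: each path is
multiplied by the sum of `c` over its arrows (`weightMap_mul`). The generators of the ideal are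
paths, hence eigenvectors, so the derivation preserves the ideal and descends to the quotient
(`weightMap_mem_pathIdeal`). This maps `k^{Q_1}` linearly to the first cohomology.

If the descended derivation is `a ↦ a x - x a`, comparing coefficients of an arrow `e` gives `c(e) =
y_{s(e)} - y_{t(e)}`, where `y_v` is the coefficient at the vertex `v` of a lift of `x`; the ideal
does not interfere, being spanned in lengths at least two. So the kernel lies in the image of the
coboundary `k^{Q_0} → k^{Q_1}` (`ker_weightClass_le`), which kills constants and has rank at most
`|Q_0| - 1`. Rank-nullity gives the bound. Finite dimension holds because a finite acyclic quiver
has finitely many paths. -/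

theorem finite_qPath [Finite V] [Finite (Quiver.Total V)] (hcycle : NoOrientedCycles V) :
    Finite (QPath V) := by
  -- Without oriented cycles, reachability by a nontrivial path is a strict order on a finite set,
  -- hence well founded; this permits induction on the endpoint of paths.
  let r : V → V → Prop := fun a b => ∃ p : Quiver.Path a b, p.length ≠ 0
  have : IsTrans V r := ⟨fun a b c ⟨p, hp⟩ ⟨q, _⟩ => ⟨p.comp q, by
    rw [Quiver.Path.length_comp]; omega⟩⟩
  have : Std.Irrefl r := ⟨fun a ⟨p, hp⟩ => hp (hcycle a p)⟩
  have hwf : WellFounded r := Finite.wellFounded_of_trans_of_irrefl r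
  have key : ∀ b : V, Finite (Σ a : V, Quiver.Path a b) := by
    intro b
    induction b using hwf.induction with
    | _ b ih =>
      let extend (e : {e : Quiver.Total V // e.right = b}) :
          (Σ a : V, Quiver.Path a e.1.left) → (Σ a : V, Quiver.Path a b) :=
        fun p => ⟨p.1, (p.2.cons e.1.hom).cast rfl e.2⟩
      have hfin : ∀ e : {e : Quiver.Total V // e.right = b},
          Finite (Σ a : V, Quiver.Path a e.1.left) := by
        rintro ⟨e, rfl⟩
        exact ih _ ⟨e.hom.toPath, by simp⟩
      -- `none` accounts for the trivial path at `b`; every other path has a last arrow into `b`.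
      let f : Option (Σ e : {e : Quiver.Total V // e.right = b},
          Σ a : V, Quiver.Path a e.1.left) → (Σ a : V, Quiver.Path a b) :=
        fun o => o.elim ⟨b, Quiver.Path.nil⟩ fun x => extend x.1 x.2
      refine Finite.of_surjective f ?_
      rintro ⟨a, p⟩
      cases p with
      | nil => exact ⟨none, rfl⟩
      | cons p e => exact ⟨some ⟨⟨⟨_, _, e⟩, rfl⟩, ⟨a, p⟩⟩, rfl⟩
  have : Finite (Σ b a : V, Quiver.Path a b) := inferInstance
  exact Finite.of_surjective (fun x : Σ b a : V, Quiver.Path a b => (⟨x.2.1, x.1, x.2.2⟩ : QPath V))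
    fun ⟨a, b, p⟩ => ⟨⟨b, a, p⟩, rfl⟩

theorem QPath.length_comp (p q : QPath V) (h : q.target = p.source) :
    (p.comp q h).length = p.length + q.length := by
  obtain ⟨a, b, p⟩ := p
  obtain ⟨c, d, q⟩ := q
  obtain rfl : d = a := h
  simp only [QPath.comp, QPath.length, Quiver.Path.length_comp, Quiver.Path.cast_rfl_rfl]
  exact add_comm _ _

theorem QPath.eq_vertex_of_length_eq_zero (p : QPath V) (h : p.length = 0) :
    p = QPath.vertex p.source := by
  obtain ⟨a, b, p⟩ := p
  cases p with
  | nil => rfl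
  | cons p e => simp [QPath.length] at h

/-- An arrow as a path of length one. -/
def QPath.ofArrow (e : Quiver.Total V) : QPath V := ⟨e.left, e.right, e.hom.toPath⟩

theorem QPath.length_ofArrow (e : Quiver.Total V) : (QPath.ofArrow e).length = 1 := rfl

/-- The sum of the values of a function on arrows along a path. -/
def pathWeight {k : Type*} [AddCommMonoid k] (c : Quiver.Total V → k) {a : V} :
    ∀ {b : V}, Quiver.Path a b → k
  | _, .nil => 0
  | _, .cons p e => pathWeight c p + c ⟨_, _, e⟩

/-- This additivity is the source of the Leibniz rule for `weightMap`. -/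
theorem pathWeight_comp {k : Type*} [AddCommMonoid k] (c : Quiver.Total V → k) {a b d : V}
    (p : Quiver.Path a b) (q : Quiver.Path b d) :
    pathWeight c (p.comp q) = pathWeight c p + pathWeight c q := by
  induction q with
  | nil => simp [pathWeight]
  | cons q e ih => simp [pathWeight, ih, add_assoc]

theorem pathWeight_add {k : Type*} [AddCommMonoid k] (c c' : Quiver.Total V → k) {a b : V}
    (p : Quiver.Path a b) : pathWeight (c + c') p = pathWeight c p + pathWeight c' p := by
  induction p with
  | nil => simp [pathWeight]
  | cons p e ih => simp only [pathWeight, ih, Pi.add_apply]; abel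

theorem pathWeight_smul {k : Type*} [Semiring k] (r : k) (c : Quiver.Total V → k) {a b : V}
    (p : Quiver.Path a b) : pathWeight (r • c) p = r * pathWeight c p := by
  induction p with
  | nil => simp [pathWeight]
  | cons p e ih => simp [pathWeight, ih, mul_add]

end Paths

section Subquotient

variable {k : Type*} [Field k] {M : Type*} [AddCommGroup M] [Module k M]

/-- The projection onto a subquotient. -/
def Subquotient.mk (Z B : Submodule k M) : Z →ₗ[k] Subquotient Z B :=
  (B.submoduleOf Z).mkQ

theorem Subquotient.mk_eq_zero_iff (Z B : Submodule k M) (z : Z) :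
    Subquotient.mk Z B z = 0 ↔ (z : M) ∈ B :=
  Submodule.Quotient.mk_eq_zero (B.submoduleOf Z)

theorem Subquotient.finite [Module.Finite k M] (Z B : Submodule k M) :
    Module.Finite k (Subquotient Z B) :=
  inferInstanceAs (Module.Finite k (Z ⧸ B.submoduleOf Z))

end Subquotient

/-! ### Diagonal derivations and coefficients in the path algebra. -/

section PathAlgebra

variable (k : Type*) [Field k] {V : Type*} [Quiver V]

namespace PathAlgebra

open Classical in
theorem coord_ofPath (p q : QPath V) :
    (basis k V).coord p (ofPath k q) = if q = p then 1 else 0 := by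
  rw [← basis_apply, Module.Basis.coord_apply, Module.Basis.repr_self, Finsupp.single_apply]

/-- The linear map multiplying each path by the total weight of its arrows. -/
def weightMap : (Quiver.Total V → k) →ₗ[k] (PathAlgebra k V →ₗ[k] PathAlgebra k V) where
  toFun c := (basis k V).constr k fun p => pathWeight c p.2.2 • ofPath k p
  map_add' c c' := (basis k V).ext fun p => by
    simp [Module.Basis.constr_basis, pathWeight_add, add_smul]
  map_smul' r c := (basis k V).ext fun p => by
    simp [Module.Basis.constr_basis, pathWeight_smul, mul_smul]

theorem weightMap_ofPath (c : Quiver.Total V → k) (p : QPath V) :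
    weightMap k c (ofPath k p) = pathWeight c p.2.2 • ofPath k p := by
  rw [← basis_apply]
  exact (basis k V).constr_basis k (fun p => pathWeight c p.2.2 • ofPath k p) p

theorem weightMap_ofPath_mul_ofPath (c : Quiver.Total V → k) (p q : QPath V) :
    weightMap k c (ofPath k p * ofPath k q) =
      ofPath k p * weightMap k c (ofPath k q) + weightMap k c (ofPath k p) * ofPath k q := by
  rw [weightMap_ofPath, weightMap_ofPath, mul_smul', smul_mul', ofPath_mul_ofPath, ← add_smul]
  by_cases h : q.target = p.source
  · rw [pathMul_of_eq k _ _ h, weightMap_ofPath]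
    obtain ⟨a, b, p⟩ := p
    obtain ⟨a', b', q⟩ := q
    obtain rfl : b' = a := h
    congr 1
    exact pathWeight_comp c q p
  · rw [pathMul_of_ne k _ _ h, map_zero, smul_zero]

theorem weightMap_mul (c : Quiver.Total V → k) (x y : PathAlgebra k V) :
    weightMap k c (x * y) = x * weightMap k c y + weightMap k c x * y := by
  induction x using induction_ofPath k with
  | h0 => simp only [zero_mul', map_zero, add_zero]
  | hadd x x' hx hx' => simp only [add_mul', map_add, hx, hx']; abel
  | hsmul r x hx => simp only [smul_mul', map_smul, hx, smul_add]
  | hp p =>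
    induction y using induction_ofPath k with
    | h0 => simp only [mul_zero', map_zero, add_zero]
    | hadd y y' hy hy' => simp only [mul_add', map_add, hy, hy']; abel
    | hsmul r y hy => simp only [mul_smul', map_smul, hy, smul_add]
    | hp q => exact weightMap_ofPath_mul_ofPath k c p q

/-- Lengths add under concatenation, so a product `p q` can equal `p` only when `q` is trivial. -/
theorem coord_ofPath_mul (p : QPath V) (y : PathAlgebra k V) :
    (basis k V).coord p (ofPath k p * y) = (basis k V).coord (QPath.vertex p.source) y := by
  classical
  induction y using induction_ofPath k with
  | h0 => simp only [mul_zero', map_zero]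
  | hadd y y' hy hy' => simp only [mul_add', map_add, hy, hy']
  | hsmul r y hy => simp only [mul_smul', map_smul, hy]
  | hp q =>
    by_cases hq : q = QPath.vertex p.source
    · rw [hq, mul_vertex k _ p rfl, coord_ofPath, coord_ofPath, if_pos rfl, if_pos rfl]
    · rw [coord_ofPath, if_neg hq, ofPath_mul_ofPath]
      by_cases h : q.target = p.source
      · rw [pathMul_of_eq k _ _ h, coord_ofPath, if_neg]
        intro hpq
        have hl := QPath.length_comp p q h
        rw [hpq] at hl
        have hv := QPath.eq_vertex_of_length_eq_zero q (by omega)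
        have hs := congrArg (fun r : QPath V => r.source) hpq
        change q.source = p.source at hs
        exact hq (hs ▸ hv)
      · rw [pathMul_of_ne k _ _ h, map_zero]

theorem coord_mul_ofPath (p : QPath V) (y : PathAlgebra k V) :
    (basis k V).coord p (y * ofPath k p) = (basis k V).coord (QPath.vertex p.target) y := by
  classical
  induction y using induction_ofPath k with
  | h0 => simp only [zero_mul', map_zero]
  | hadd y y' hy hy' => simp only [add_mul', map_add, hy, hy']
  | hsmul r y hy => simp only [smul_mul', map_smul, hy]
  | hp q =>
    by_cases hq : q = QPath.vertex p.target
    · rw [hq, vertex_mul k _ p rfl, coord_ofPath, coord_ofPath, if_pos rfl, if_pos rfl]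
    · rw [coord_ofPath, if_neg hq, ofPath_mul_ofPath]
      by_cases h : p.target = q.source
      · rw [pathMul_of_eq k _ _ h, coord_ofPath, if_neg]
        intro hpq
        have hl := QPath.length_comp q p h
        rw [hpq] at hl
        have hv := QPath.eq_vertex_of_length_eq_zero q (by omega)
        exact hq (h ▸ hv)
      · rw [pathMul_of_ne k _ _ h, map_zero]

/-! ### The filtration by path length. -/

variable (V) in
/-- The subspace spanned by the paths of length at least `n`. -/
def spanLengthGE (n : ℕ) : Submodule k (PathAlgebra k V) :=
  Submodule.span k (ofPath k '' {p | n ≤ p.length})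

theorem ofPath_mem_spanLengthGE {n : ℕ} {p : QPath V} (h : n ≤ p.length) :
    ofPath k p ∈ spanLengthGE k V n :=
  Submodule.subset_span ⟨p, h, rfl⟩

/-- With `n = 2` and `p` an arrow, this makes coefficients of arrows well defined modulo the ideal.
-/
theorem coord_eq_zero_of_mem_spanLengthGE {n : ℕ} {p : QPath V} (h : p.length < n)
    {x : PathAlgebra k V} (hx : x ∈ spanLengthGE k V n) : (basis k V).coord p x = 0 := by
  classical
  induction hx using Submodule.span_induction with
  | mem x hx =>
    obtain ⟨q, hq, rfl⟩ := hx
    rw [coord_ofPath, if_neg]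
    rintro rfl
    exact absurd hq (not_le.2 h)
  | zero => exact map_zero _
  | add x y _ _ hx hy => rw [map_add, hx, hy, add_zero]
  | smul c x _ hx => rw [map_smul, hx, smul_zero]

theorem pathMul_mem_spanLengthGE {n : ℕ} (p q : QPath V) (h : n ≤ p.length + q.length) :
    pathMul k p q ∈ spanLengthGE k V n := by
  by_cases hc : q.target = p.source
  · rw [pathMul_of_eq k _ _ hc]
    exact ofPath_mem_spanLengthGE k (by rwa [QPath.length_comp])
  · rw [pathMul_of_ne k _ _ hc]
    exact zero_mem _

theorem mul_mem_spanLengthGE_right {n : ℕ} (x : PathAlgebra k V) {y : PathAlgebra k V}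
    (hy : y ∈ spanLengthGE k V n) : x * y ∈ spanLengthGE k V n := by
  induction x using induction_ofPath k with
  | h0 => rw [zero_mul']; exact zero_mem _
  | hadd x x' hx hx' => rw [add_mul']; exact add_mem hx hx'
  | hsmul r x hx => rw [smul_mul']; exact Submodule.smul_mem _ _ hx
  | hp p =>
    induction hy using Submodule.span_induction with
    | mem y hy =>
      obtain ⟨q, hq, rfl⟩ := hy
      rw [ofPath_mul_ofPath]
      exact pathMul_mem_spanLengthGE k p q (le_add_left hq)
    | zero => rw [mul_zero']; exact zero_mem _
    | add y z _ _ hy hz => rw [mul_add']; exact add_mem hy hz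
    | smul c y _ hy => rw [mul_smul']; exact Submodule.smul_mem _ _ hy

theorem mul_mem_spanLengthGE_left {n : ℕ} {x : PathAlgebra k V} (y : PathAlgebra k V)
    (hx : x ∈ spanLengthGE k V n) : x * y ∈ spanLengthGE k V n := by
  induction y using induction_ofPath k with
  | h0 => rw [mul_zero']; exact zero_mem _
  | hadd x x' hx hx' => rw [mul_add']; exact add_mem hx hx'
  | hsmul r x hx => rw [mul_smul']; exact Submodule.smul_mem _ _ hx
  | hp p =>
    induction hx using Submodule.span_induction with
    | mem x hx =>
      obtain ⟨q, hq, rfl⟩ := hx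
      rw [ofPath_mul_ofPath]
      exact pathMul_mem_spanLengthGE k q p (le_add_right hq)
    | zero => rw [zero_mul']; exact zero_mem _
    | add y z _ _ hy hz => rw [add_mul']; exact add_mem hy hz
    | smul c y _ hy => rw [smul_mul']; exact Submodule.smul_mem _ _ hy

end PathAlgebra

/-! ### Descent to the monomial algebra. -/

open PathAlgebra

variable [Fintype V]

variable (V) in
/-- The two-sided ideal spanned by the paths of length at least `n`. -/
def idealLengthGE (n : ℕ) : TwoSidedIdeal (PathAlgebra k V) :=
  TwoSidedIdeal.mk' (spanLengthGE k V n) (zero_mem _) (fun hx hy => add_mem hx hy)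
    (fun hx => neg_mem hx) (fun hy => mul_mem_spanLengthGE_right k _ hy)
    (fun hx => mul_mem_spanLengthGE_left k _ hx)

theorem pathIdeal_le_spanLengthGE {n : ℕ} {Z : Set (QPath V)} (hZ : ∀ γ ∈ Z, n ≤ γ.length)
    {x : PathAlgebra k V} (hx : x ∈ pathIdeal k Z) : x ∈ spanLengthGE k V n := by
  have hle : pathIdeal k Z ≤ idealLengthGE k V n := by
    refine TwoSidedIdeal.span_le.2 ?_
    rintro _ ⟨γ, hγ, rfl⟩
    exact (TwoSidedIdeal.mem_mk' ..).2 (ofPath_mem_spanLengthGE k (hZ γ hγ))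
  exact (TwoSidedIdeal.mem_mk' ..).1 (hle hx)

theorem ofPath_mem_pathIdeal {Z : Set (QPath V)} {γ : QPath V} (hγ : γ ∈ Z) :
    ofPath k γ ∈ pathIdeal k Z :=
  TwoSidedIdeal.subset_span ⟨γ, hγ, rfl⟩

theorem smul_mem_pathIdeal {Z : Set (QPath V)} (r : k) {x : PathAlgebra k V}
    (hx : x ∈ pathIdeal k Z) : r • x ∈ pathIdeal k Z := by
  rw [← one_mul x, ← smul_mul_assoc]
  exact TwoSidedIdeal.mul_mem_left _ _ _ hx

theorem weightMap_mem_pathIdeal {Z : Set (QPath V)} (c : Quiver.Total V → k)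
    {x : PathAlgebra k V} (hx : x ∈ pathIdeal k Z) : weightMap k c x ∈ pathIdeal k Z := by
  -- By the Leibniz rule, the elements of the ideal whose image stays in it form a two-sided ideal,
  -- so only the generators need checking.
  let J : TwoSidedIdeal (PathAlgebra k V) :=
    TwoSidedIdeal.mk' {x | x ∈ pathIdeal k Z ∧ weightMap k c x ∈ pathIdeal k Z}
      ⟨zero_mem _, by rw [map_zero]; exact zero_mem _⟩
      (fun hx hy => ⟨add_mem hx.1 hy.1, by rw [map_add]; exact add_mem hx.2 hy.2⟩)
      (fun hx => ⟨neg_mem hx.1, by rw [map_neg]; exact neg_mem hx.2⟩)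
      (fun hy => ⟨TwoSidedIdeal.mul_mem_left _ _ _ hy.1, by
        rw [weightMap_mul]
        exact add_mem (TwoSidedIdeal.mul_mem_left _ _ _ hy.2)
          (TwoSidedIdeal.mul_mem_left _ _ _ hy.1)⟩)
      (fun hx => ⟨TwoSidedIdeal.mul_mem_right _ _ _ hx.1, by
        rw [weightMap_mul]
        exact add_mem (TwoSidedIdeal.mul_mem_right _ _ _ hx.1)
          (TwoSidedIdeal.mul_mem_right _ _ _ hx.2)⟩)
  have hle : pathIdeal k Z ≤ J := by
    refine TwoSidedIdeal.span_le.2 ?_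
    rintro _ ⟨γ, hγ, rfl⟩
    refine (TwoSidedIdeal.mem_mk' ..).2 ⟨ofPath_mem_pathIdeal k hγ, ?_⟩
    rw [weightMap_ofPath]
    exact smul_mem_pathIdeal k _ (ofPath_mem_pathIdeal k hγ)
  exact ((TwoSidedIdeal.mem_mk' ..).1 (hle hx)).2

/-- The quotient map from the path algebra. -/
def quotientMap (Z : Set (QPath V)) : PathAlgebra k V →ₐ[k] MonomialAlgebra k Z :=
  (pathIdeal k Z).ringCon.mkₐ k

theorem quotientMap_surjective (Z : Set (QPath V)) : Function.Surjective (quotientMap k Z) :=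
  Quotient.mk''_surjective

theorem quotientMap_eq_zero_iff (Z : Set (QPath V)) (x : PathAlgebra k V) :
    quotientMap k Z x = 0 ↔ x ∈ pathIdeal k Z := by
  rw [TwoSidedIdeal.mem_iff]
  exact (pathIdeal k Z).ringCon.eq (a := x) (b := 0)

theorem exists_linear_section (Z : Set (QPath V)) :
    ∃ s : MonomialAlgebra k Z →ₗ[k] PathAlgebra k V, ∀ x, quotientMap k Z (s x) = x := by
  obtain ⟨s, hs⟩ := (quotientMap k Z).toLinearMap.exists_rightInverse_of_surjective
    (LinearMap.range_eq_top.2 (quotientMap_surjective k Z))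
  exact ⟨s, fun x => LinearMap.congr_fun hs x⟩

/-- A linear section of the quotient map. -/
def quotientSection (Z : Set (QPath V)) : MonomialAlgebra k Z →ₗ[k] PathAlgebra k V :=
  (exists_linear_section k Z).choose

theorem quotientMap_quotientSection (Z : Set (QPath V)) (x : MonomialAlgebra k Z) :
    quotientMap k Z (quotientSection k Z x) = x :=
  (exists_linear_section k Z).choose_spec x

/-- The weighted derivation of the monomial algebra attached to a function on arrows. -/
def weightDerivation (Z : Set (QPath V)) :
    (Quiver.Total V → k) →ₗ[k] (MonomialAlgebra k Z →ₗ[k] MonomialAlgebra k Z) :=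
  (LinearMap.lcomp k _ (quotientSection k Z)) ∘ₗ
    (LinearMap.llcomp k _ _ _ (quotientMap k Z).toLinearMap) ∘ₗ weightMap k

/-- Two lifts differ by an element of the ideal, which `weightMap` preserves, so the chosen section
does not matter. -/
theorem weightDerivation_quotientMap (Z : Set (QPath V)) (c : Quiver.Total V → k)
    (x : PathAlgebra k V) :
    weightDerivation k Z c (quotientMap k Z x) = quotientMap k Z (weightMap k c x) := by
  change quotientMap k Z (weightMap k c (quotientSection k Z (quotientMap k Z x))) = _
  rw [← sub_eq_zero, ← map_sub, ← map_sub, quotientMap_eq_zero_iff]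
  apply weightMap_mem_pathIdeal
  rw [← quotientMap_eq_zero_iff, map_sub, quotientMap_quotientSection, sub_self]

theorem weightDerivation_mem_ker (Z : Set (QPath V)) (c : Quiver.Total V → k) :
    weightDerivation k Z c ∈ LinearMap.ker (hochschildD1 k (MonomialAlgebra k Z)) := by
  rw [mem_ker_hochschildD1]
  intro a b
  obtain ⟨x, rfl⟩ := quotientMap_surjective k Z a
  obtain ⟨y, rfl⟩ := quotientMap_surjective k Z b
  rw [← map_mul, weightDerivation_quotientMap, weightDerivation_quotientMap,
    weightDerivation_quotientMap, weightMap_mul, map_add, map_mul, map_mul]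

/-! ### Comparison with inner derivations. -/

/-- The coboundary of a function on vertices: its difference between source and target of each
arrow. -/
def arrowDifference (k : Type*) [Field k] (V : Type*) [Quiver V] :
    (V → k) →ₗ[k] (Quiver.Total V → k) :=
  LinearMap.funLeft k k (fun e : Quiver.Total V => e.left) -
    LinearMap.funLeft k k (fun e : Quiver.Total V => e.right)

theorem mem_range_arrowDifference {Z : Set (QPath V)} (hZ : ∀ γ ∈ Z, 2 ≤ γ.length)
    {c : Quiver.Total V → k}
    (hc : weightDerivation k Z c ∈ LinearMap.range (hochschildD0 k (MonomialAlgebra k Z))) :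
    c ∈ LinearMap.range (arrowDifference k V) := by
  obtain ⟨x, hx⟩ := hc
  obtain ⟨y, rfl⟩ := quotientMap_surjective k Z x
  -- Only the vertex coefficients of the lift `y` affect the coefficient of an arrow `e` in `e y - y
  -- e`.
  refine ⟨fun v => (basis k V).coord (QPath.vertex v) y, funext fun e => ?_⟩
  have h := LinearMap.congr_fun hx (quotientMap k Z (ofPath k (QPath.ofArrow e)))
  rw [hochschildD0_apply, weightDerivation_quotientMap, ← map_mul, ← map_mul, ← map_sub,
    ← sub_eq_zero, ← map_sub, quotientMap_eq_zero_iff] at h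
  have h' := coord_eq_zero_of_mem_spanLengthGE k (p := QPath.ofArrow e)
    (by rw [QPath.length_ofArrow]; omega) (pathIdeal_le_spanLengthGE k hZ h)
  rw [map_sub, map_sub, coord_ofPath_mul, coord_mul_ofPath, weightMap_ofPath, map_smul,
    coord_ofPath, if_pos rfl, sub_eq_zero] at h'
  refine (show _ = _ from h').trans ?_
  simp [QPath.ofArrow, pathWeight, Quiver.Hom.toPath]

theorem finrank_range_arrowDifference_lt [Nonempty V] :
    Module.finrank k (LinearMap.range (arrowDifference k V)) + 1 ≤ Fintype.card V := by
  have h := (arrowDifference k V).finrank_range_add_finrank_ker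
  rw [Module.finrank_fintype_fun_eq_card] at h
  have hpos : 0 < Module.finrank k (LinearMap.ker (arrowDifference k V)) := by
    rw [Module.finrank_pos_iff_exists_ne_zero]
    -- The constant function 1 is killed, and is nonzero since there is a vertex.
    refine ⟨⟨1, ?_⟩, fun h0 => one_ne_zero (congrArg Subtype.val h0)⟩
    rw [LinearMap.mem_ker]
    ext e
    simp [arrowDifference]
  omega

/-- The class in cohomology of the weighted derivations. -/
def weightClass (Z : Set (QPath V)) :
    (Quiver.Total V → k) →ₗ[k] HH1 k (MonomialAlgebra k Z) :=
  Subquotient.mk _ _ ∘ₗ (weightDerivation k Z).codRestrict _ (weightDerivation_mem_ker k Z)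

theorem ker_weightClass_le {Z : Set (QPath V)} (hZ : ∀ γ ∈ Z, 2 ≤ γ.length) :
    LinearMap.ker (weightClass k Z) ≤ LinearMap.range (arrowDifference k V) := by
  intro c hc
  apply mem_range_arrowDifference k hZ
  exact (Subquotient.mk_eq_zero_iff _ _ _).1 (LinearMap.mem_ker.1 hc)

theorem finite_monomialAlgebra [Finite (QPath V)] (Z : Set (QPath V)) :
    Module.Finite k (MonomialAlgebra k Z) :=
  have : Module.Finite k (PathAlgebra k V) := Module.Finite.of_basis (basis k V)
  Module.Finite.of_surjective (quotientMap k Z).toLinearMap (quotientMap_surjective k Z)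

end PathAlgebra

theorem finite_HH1 (k : Type*) [Field k] (A : Type*) [Ring A] [Algebra k A] [Module.Finite k A] :
    Module.Finite k (HH1 k A) :=
  Subquotient.finite _ _

end MonomialHochschild

end

/-! ### The dimension bound. -/

theorem corollary5p2 (k : Type*) [Field k] (V : Type*) [Fintype V] [Quiver V]
    [Finite (Quiver.Total V)]
    (hconn : MonomialHochschild.IsConnectedQuiver V)
    (hcycle : MonomialHochschild.NoOrientedCycles V)
    (Z : Set (MonomialHochschild.QPath V))
    (hZmin : MonomialHochschild.IsMinimalPathSet Z)
    (hZlen : ∀ γ ∈ Z, 2 ≤ γ.length) :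
    Module.Finite k (MonomialHochschild.HH1 k (MonomialHochschild.MonomialAlgebra k Z)) ∧
      (1 : ℤ) - (Fintype.card V : ℤ) + (Nat.card (Quiver.Total V) : ℤ) ≤
        (Module.finrank k
          (MonomialHochschild.HH1 k (MonomialHochschild.MonomialAlgebra k Z)) : ℤ) := by
  have := hconn.1
  have := MonomialHochschild.finite_qPath hcycle
  have := MonomialHochschild.finite_monomialAlgebra k Z
  have hfin := MonomialHochschild.finite_HH1 k (MonomialHochschild.MonomialAlgebra k Z)
  refine ⟨hfin, ?_⟩
  have := Fintype.ofFinite (Quiver.Total V)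
  have hrank := (MonomialHochschild.weightClass k Z).finrank_range_add_finrank_ker
  rw [Module.finrank_fintype_fun_eq_card, ← Nat.card_eq_fintype_card] at hrank
  have hker := Submodule.finrank_mono (MonomialHochschild.ker_weightClass_le k hZlen)
  have hlt := MonomialHochschild.finrank_range_arrowDifference_lt k (V := V)
  -- Finiteness is essential here: `finrank` would be 0 on an infinite-dimensional space.
  have hle := Submodule.finrank_le (LinearMap.range (MonomialHochschild.weightClass k Z))
  omega
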